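/- For integers $p\ge 1$, $n_0>p$ and $\ell\ge 0$, put $n_\ell=n_0 2^\ell$, $h_\ell=1/n_\ell$ and $m_\ell=n_\ell+p$, and let $\varphi^{(1)},\dots,\varphi^{(m_\ell)}$ be the normalized B-splines of degree $p$ on $(0,1)$ for the open knot vector $(0,\dots,0,h_\ell,2h_\ell,\dots,(n_\ell-1)h_\ell,1,\dots,1)$, in which $0$ and $1$ are repeated $p+1$ times. Let $M_\ell,K_\ell,A_\ell\in\mathbb R^{m_\ell\times m_\ell}$ be the matrices $$(M_\ell)_{ij}=\int_0^1\varphi^{(i)}\varphi^{(j)}\,dx,\qquad (K_\ell)_{ij}=\int_0^1(\varphi^{(i)})'(\varphi^{(j)})'\,dx,\qquad A_\ell=K_\ell+M_\ell.$$ Split the indices into $\Gamma$, consisting of the first $p$ and the last $p$ indices, and the set $I$ of the remaining ones, denote the corresponding blocks of $A_\ell$ by $A_{\Gamma\Gamma,\ell}$, $A_{I\Gamma,\ell}$, $A_{II,\ell}$, and let $C_\ell\in\mathbb R^{m_\ell\times m_\ell}$ be the matrix whose $\Gamma\Gamma$ block is the Schur complement $A_{\Gamma\Gamma,\ell}-A_{I\Gamma,\ell}^T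 A_{II,\ell}^{-1}A_{I\Gamma,\ell}$ and whose other entries are $0$. Let $\mathcal A_\ell$ be the stiffness matrix of the bilinear form $(\nabla u,\nabla v)_{L^2(\Omega)}+(u,v)_{L^2(\Omega)}$ on $\Omega=(0,1)^2$ with respect to the tensor product basis $(x,y)\mapsto\varphi^{(i)}(x)\varphi^{(j)}(y)$, that is, $\mathcal A_\ell=K_\ell\otimes M_\ell+M_\ell\otimes K_\ell+M_\ell\otimes M_\ell$, and let $$\mathcal L_\ell=h_\ell^{-2}\,M_\ell\otimes M_\ell+C_\ell\otimes M_\ell+M_\ell\otimes C_\ell .$$ Then there is a constant $c>0$, independent of $\ell$, $p$ and $n_0$, such that $\mathcal A_\ell\le c\,\mathcal L_\ell$ in the spectral sense, i.e. $c\,\mathcal L_\ell-\mathcal A_\ell$ is positive semidefinite, for all such $p$, $n_0$ and $\ell$. -/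

import Mathlib

namespace SplineMG

open MeasureTheory

/-- Number of subintervals on grid level `ℓ`, starting from `n₀` subintervals. -/
def numIntervals (n₀ ℓ : ℕ) : ℕ := n₀ * 2 ^ ℓ

/-- Mesh size of the uniform grid on `(0,1)` with `n` subintervals. -/
noncomputable def meshSize (n : ℕ) : ℝ := 1 / (n : ℝ)

/-- Open knot vector `(0,…,0, h, 2h, …, (n-1)h, 1,…,1)`, `h = 1/n`, whose first and last knots
are repeated `p+1` times; the knots are numbered `0, …, n+2p`. The natural-number subtraction
truncates on purpose. -/
noncomputable def knot (p n i : ℕ) : ℝ := ((min (i - p) n : ℕ) : ℝ) / (n : ℝ)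

/-- Normalized B-splines of degree `k` over a knot sequence `t` (Cox–de Boor recursion). A term
whose denominator vanishes is dropped, which is the convention `x / 0 = 0`. -/
noncomputable def bspline (t : ℕ → ℝ) : ℕ → ℕ → ℝ → ℝ
  | 0, i, x => Set.indicator (Set.Ico (t i) (t (i + 1))) (fun _ => (1 : ℝ)) x
  | k + 1, i, x =>
      (x - t i) / (t (i + k + 1) - t i) * bspline t k i x +
      (t (i + k + 2) - x) / (t (i + k + 2) - t (i + 1)) * bspline t k (i + 1) x

/-- The `n + p` B-spline basis functions of degree `p` on the uniform grid of `(0,1)` with `n`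
subintervals (numbered from `0`). -/
noncomputable def basisFun (p n : ℕ) (i : Fin (n + p)) : ℝ → ℝ :=
  bspline (knot p n) p i

/-- One-dimensional mass matrix. -/
noncomputable def massMatrix (p n : ℕ) : Matrix (Fin (n + p)) (Fin (n + p)) ℝ :=
  Matrix.of fun i j => ∫ x in Set.Ioo (0 : ℝ) 1, basisFun p n i x * basisFun p n j x

/-- Matrix of the scalar product `(u', v')` in `L²(0,1)`. (The B-splines of degree `p ≥ 1` are
continuous and piecewise polynomial, so their classical derivative exists off the knots and is
their weak derivative.) -/
noncomputable def gradMatrix (p n : ℕ) : Matrix (Fin (n + p)) (Fin (n + p)) ℝ :=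
  Matrix.of fun i j =>
    ∫ x in Set.Ioo (0 : ℝ) 1, deriv (basisFun p n i) x * deriv (basisFun p n j) x

/-- One-dimensional stiffness matrix `A`, of the bilinear form `(u', v') + (u, v)`. -/
noncomputable def stiffnessMatrix (p n : ℕ) : Matrix (Fin (n + p)) (Fin (n + p)) ℝ :=
  gradMatrix p n + massMatrix p n

/-- The indices of the boundary basis functions: the first `p` and the last `p` ones. -/
def IsBoundary (p n : ℕ) (i : Fin (n + p)) : Prop := (i : ℕ) < p ∨ n ≤ (i : ℕ)

instance (p n : ℕ) : DecidablePred (IsBoundary p n) := fun i =>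
  inferInstanceAs (Decidable ((i : ℕ) < p ∨ n ≤ (i : ℕ)))

/-- The Schur complement `A_ΓΓ - A_IΓᵀ A_II⁻¹ A_IΓ` of the stiffness matrix with respect to the
splitting of the indices into boundary (`Γ`) and inner (`I`) ones. -/
noncomputable def schurMatrix (p n : ℕ) :
    Matrix {i // IsBoundary p n i} {i // IsBoundary p n i} ℝ :=
  let A := stiffnessMatrix p n
  let AΓΓ := A.toBlock (IsBoundary p n) (IsBoundary p n)
  let AIΓ := A.toBlock (fun i => ¬ IsBoundary p n i) (IsBoundary p n)
  let AII := A.toBlock (fun i => ¬ IsBoundary p n i) (fun i => ¬ IsBoundary p n i)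
  AΓΓ - AIΓ.transpose * AII⁻¹ * AIΓ

/-- The boundary correction `C`: the Schur complement in the boundary block, zero elsewhere. -/
noncomputable def boundaryCorrection (p n : ℕ) : Matrix (Fin (n + p)) (Fin (n + p)) ℝ :=
  Matrix.reindex (Equiv.sumCompl (IsBoundary p n)) (Equiv.sumCompl (IsBoundary p n))
    (Matrix.fromBlocks (schurMatrix p n) 0 0 0)

/-- Tensor product B-spline basis functions `(x, y) ↦ φ_{i₁}(x) φ_{i₂}(y)`. -/
noncomputable def tensorBasisFun (p n : ℕ) (i : Fin (n + p) × Fin (n + p)) (x y : ℝ) : ℝ :=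
  basisFun p n i.1 x * basisFun p n i.2 y

/-- The open unit square. -/
def unitSquare : Set (ℝ × ℝ) := Set.Ioo (0 : ℝ) 1 ×ˢ Set.Ioo (0 : ℝ) 1

/-- Two-dimensional stiffness matrix: the matrix of `(∂ₓu, ∂ₓv) + (∂ᵧu, ∂ᵧv) + (u, v)` on the
unit square with respect to the tensor product B-spline basis. -/
noncomputable def stiffnessMatrix2D (p n : ℕ) :
    Matrix (Fin (n + p) × Fin (n + p)) (Fin (n + p) × Fin (n + p)) ℝ :=
  Matrix.of fun i j =>
    (∫ z in unitSquare, deriv (fun x => tensorBasisFun p n i x z.2) z.1 *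
      deriv (fun x => tensorBasisFun p n j x z.2) z.1) +
    (∫ z in unitSquare, deriv (fun y => tensorBasisFun p n i z.1 y) z.2 *
      deriv (fun y => tensorBasisFun p n j z.1 y) z.2) +
    ∫ z in unitSquare, tensorBasisFun p n i z.1 z.2 * tensorBasisFun p n j z.1 z.2

open scoped Kronecker in
/-- The two-dimensional smoother matrix `h⁻² M ⊗ M + C ⊗ M + M ⊗ C`. -/
noncomputable def smootherMatrix2D (p n : ℕ) :
    Matrix (Fin (n + p) × Fin (n + p)) (Fin (n + p) × Fin (n + p)) ℝ :=
  (meshSize n ^ 2)⁻¹ • (massMatrix p n ⊗ₖ massMatrix p n) +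
    boundaryCorrection p n ⊗ₖ massMatrix p n + massMatrix p n ⊗ₖ boundaryCorrection p n

open scoped Kronecker in
/-- Consistency check: the two-dimensional stiffness matrix is `K ⊗ M + M ⊗ K + M ⊗ M`. -/
theorem stiffnessMatrix2D_eq (p n : ℕ) :
    stiffnessMatrix2D p n = gradMatrix p n ⊗ₖ massMatrix p n +
      massMatrix p n ⊗ₖ gradMatrix p n + massMatrix p n ⊗ₖ massMatrix p n := by
  have key : ∀ f g : ℝ → ℝ, ∫ z in unitSquare, f z.1 * g z.2 =
      (∫ x in Set.Ioo (0 : ℝ) 1, f x) * ∫ y in Set.Ioo (0 : ℝ) 1, g y := by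
    intro f g
    rw [unitSquare, Measure.volume_eq_prod, setIntegral_prod_mul]
  ext i j
  simp only [stiffnessMatrix2D, tensorBasisFun, Matrix.of_apply, Matrix.add_apply,
    Matrix.kroneckerMap_apply, gradMatrix, massMatrix, deriv_mul_const_field,
    deriv_const_mul_field, ← key]
  congr 1
  · congr 1 <;> (congr 1; ext z; ring)
  · congr 1; ext z; ring

end SplineMG

namespace SplineMG

open MeasureTheory Set Filter Topology

/-! Everything reduces to the univariate estimate A ≤ C + 13 h⁻² M (`stiffnessMatrix_form_le`): its
Kronecker products with M ≥ 0, taken in both directions and added, give the claim with c = 26.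

Let a be the form of A. Since C is a Schur complement, uᵀ(A - C)u equals a(v,v), where v is the
a-orthogonal projection of u onto the span of the inner B-splines (`exists_schur_decomposition`). So
it suffices to show a(v,v) ≤ 13 n² ‖u‖² (`energy_le`). Inner B-splines are uniform B-splines
supported in [0,1]; their derivatives lie in the same kind of space, one degree lower, and vanish at
0 and 1 while the degree is positive. Hence, for p ≥ 2, integration by parts has no boundary terms,
and a(v,v) = a(u,v) = -(u,v'') + (u,v), with v'' taken cellwise. It remains to bound ‖v''‖ by ‖v'‖.

This inverse inequality, ‖w'‖² ≤ 12 n² ‖w‖², has a constant free of p (`inverse_inequality`). In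
degree one it is a computation on each cell. In higher degree, ‖w'‖² = -(w,w'') ≤ ‖w‖ ‖w''‖, and the
inequality for w' bounds ‖w''‖ by √12 n ‖w'‖, so the same constant is reproduced. For p = 1 the
univariate estimate follows directly from the cellwise computation. -/

/-! ### Piecewise polynomial functions on the uniform grid -/

/-- The `j`-th open cell of the uniform grid with `n` subintervals. -/
def cell (n j : ℕ) : Set ℝ := Ioo ((j : ℝ) / n) (((j + 1 : ℕ) : ℝ) / n)

/-- Functions that agree with a polynomial on every open cell of `(0,1)`. -/
def IsPiecewisePoly (n : ℕ) (f : ℝ → ℝ) : Prop :=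
  ∀ j < n, ∃ P : Polynomial ℝ, ∀ x ∈ cell n j, f x = P.eval x

variable {n : ℕ} {f g : ℝ → ℝ}

theorem isOpen_cell (n j : ℕ) : IsOpen (cell n j) := isOpen_Ioo

theorem IsPiecewisePoly.add (hf : IsPiecewisePoly n f) (hg : IsPiecewisePoly n g) :
    IsPiecewisePoly n fun x => f x + g x := fun j hj => by
  obtain ⟨P, hP⟩ := hf j hj
  obtain ⟨Q, hQ⟩ := hg j hj
  exact ⟨P + Q, fun x hx => by simp [hP x hx, hQ x hx]⟩

theorem IsPiecewisePoly.mul (hf : IsPiecewisePoly n f) (hg : IsPiecewisePoly n g) :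
    IsPiecewisePoly n fun x => f x * g x := fun j hj => by
  obtain ⟨P, hP⟩ := hf j hj
  obtain ⟨Q, hQ⟩ := hg j hj
  exact ⟨P * Q, fun x hx => by simp [hP x hx, hQ x hx]⟩

theorem isPiecewisePoly_eval (P : Polynomial ℝ) : IsPiecewisePoly n fun x => P.eval x :=
  fun _ _ => ⟨P, fun _ _ => rfl⟩

theorem isPiecewisePoly_const (c : ℝ) : IsPiecewisePoly n fun _ => c :=
  fun _ _ => ⟨Polynomial.C c, fun _ _ => by simp⟩

theorem IsPiecewisePoly.const_mul (hf : IsPiecewisePoly n f) (c : ℝ) :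
    IsPiecewisePoly n fun x => c * f x := (isPiecewisePoly_const c).mul hf

theorem IsPiecewisePoly.sq (hf : IsPiecewisePoly n f) : IsPiecewisePoly n fun x => f x ^ 2 := by
  simpa only [_root_.sq] using hf.mul hf

theorem IsPiecewisePoly.sum {ι : Type*} (s : Finset ι) {F : ι → ℝ → ℝ}
    (hF : ∀ i ∈ s, IsPiecewisePoly n (F i)) : IsPiecewisePoly n fun x => ∑ i ∈ s, F i x := by
  classical
  induction s using Finset.induction_on with
  | empty => simpa using isPiecewisePoly_const 0
  | insert a s ha ih =>
    simp only [Finset.sum_insert ha]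
    exact (hF a (by simp)).add (ih fun i hi => hF i (by simp [hi]))

theorem IsPiecewisePoly.differentiableAt (hf : IsPiecewisePoly n f) {j : ℕ} (hj : j < n) {x : ℝ}
    (hx : x ∈ cell n j) : DifferentiableAt ℝ f x := by
  obtain ⟨P, hP⟩ := hf j hj
  have : f =ᶠ[𝓝 x] fun x => P.eval x := by
    filter_upwards [(isOpen_cell n j).mem_nhds hx] with y hy using hP y hy
  exact P.differentiableAt.congr_of_eventuallyEq this

theorem IsPiecewisePoly.deriv (hf : IsPiecewisePoly n f) : IsPiecewisePoly n (deriv f) := by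
  intro j hj
  obtain ⟨P, hP⟩ := hf j hj
  refine ⟨Polynomial.derivative P, fun x hx => ?_⟩
  have : f =ᶠ[𝓝 x] fun x => P.eval x := by
    filter_upwards [(isOpen_cell n j).mem_nhds hx] with y hy using hP y hy
  rw [this.deriv_eq, Polynomial.deriv]

/-- The grid points. -/
def gridPoints (n : ℕ) : Set ℝ := range fun j : ℕ => (j : ℝ) / n

theorem countable_gridPoints (n : ℕ) : (gridPoints n).Countable := countable_range _

theorem exists_mem_cell (hn : 0 < n) {x : ℝ} (hx : x ∈ Ioo (0 : ℝ) 1) (hx' : x ∉ gridPoints n) :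
    ∃ j < n, x ∈ cell n j := by
  have hn' : (0 : ℝ) < n := by exact_mod_cast hn
  have h0 : 0 ≤ x * n := by have := hx.1; positivity
  have hle := Nat.floor_le h0
  have hlt := Nat.lt_floor_add_one (x * n)
  refine ⟨⌊x * n⌋₊, ?_, ?_, ?_⟩
  · rw [Nat.floor_lt h0]
    nlinarith [hx.2]
  · rw [div_lt_iff₀ hn']
    refine lt_of_le_of_ne hle fun h => hx' ⟨⌊x * n⌋₊, ?_⟩
    simp only [h]
    field_simp
  · rw [lt_div_iff₀ hn']
    push_cast
    exact hlt

theorem ae_mem_cell (hn : 0 < n) :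
    ∀ᵐ x ∂(volume.restrict (Ioo (0 : ℝ) 1)), ∃ j < n, x ∈ cell n j := by
  rw [ae_restrict_iff' measurableSet_Ioo]
  have : ∀ᵐ x ∂(volume : Measure ℝ), x ∉ gridPoints n :=
    (countable_gridPoints n).ae_notMem _
  filter_upwards [this] with x hx hx' using exists_mem_cell hn hx' hx

theorem div_le_div_succ (n j : ℕ) : (j : ℝ) / n ≤ ((j + 1 : ℕ) : ℝ) / n := by
  gcongr; omega

theorem cell_subset_Ioo {j : ℕ} (hj : j < n) : cell n j ⊆ Ioo 0 1 := by
  have hn' : (0 : ℝ) < n := by exact_mod_cast (by omega : 0 < n)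
  intro x hx
  refine ⟨lt_of_le_of_lt (by positivity) hx.1, hx.2.trans_le ?_⟩
  rw [div_le_one hn']
  exact_mod_cast hj

theorem IsPiecewisePoly.intervalIntegrable_cell (hf : IsPiecewisePoly n f) {j : ℕ} (hj : j < n) :
    IntervalIntegrable f volume ((j : ℝ) / n) (((j + 1 : ℕ) : ℝ) / n) := by
  obtain ⟨P, hP⟩ := hf j hj
  have h := (P.continuous.intervalIntegrable (μ := volume) ((j : ℝ) / n) (((j + 1 : ℕ) : ℝ) / n))
  rw [intervalIntegrable_iff_integrableOn_Ioo_of_le (div_le_div_succ n j)] at h ⊢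
  exact h.congr_fun (fun x hx => (hP x hx).symm) measurableSet_Ioo

theorem IsPiecewisePoly.intervalIntegrable (hn : 0 < n) (hf : IsPiecewisePoly n f) :
    IntervalIntegrable f volume 0 1 := by
  have := IntervalIntegrable.trans_iterate (a := fun j : ℕ => (j : ℝ) / n) (n := n) (f := f)
    (μ := volume) fun j hj => hf.intervalIntegrable_cell hj
  have hn' : (n : ℝ) ≠ 0 := by exact_mod_cast hn.ne'
  simpa [hn'] using this

theorem IsPiecewisePoly.integrableOn (hn : 0 < n) (hf : IsPiecewisePoly n f) :
    IntegrableOn f (Ioo 0 1) :=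
  (intervalIntegrable_iff_integrableOn_Ioo_of_le zero_le_one).1 (hf.intervalIntegrable hn)

theorem setIntegral_Ioo_eq (f : ℝ → ℝ) : ∫ x in Ioo (0 : ℝ) 1, f x = ∫ x in (0 : ℝ)..1, f x := by
  rw [intervalIntegral.integral_of_le zero_le_one, integral_Ioc_eq_integral_Ioo]

theorem setIntegral_congr_cell (hn : 0 < n) (h : ∀ j < n, ∀ x ∈ cell n j, f x = g x) :
    ∫ x in Ioo (0 : ℝ) 1, f x = ∫ x in Ioo (0 : ℝ) 1, g x := by
  apply integral_congr_ae
  filter_upwards [ae_mem_cell hn] with x hx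
  obtain ⟨j, hj, hx⟩ := hx
  exact h j hj x hx

/-! ### Integration by parts and the cellwise inverse inequality -/

/-- Integration by parts when one factor vanishes at both end points. -/
theorem integral_deriv_mul_eq_neg (hn : 0 < n) (hf : IsPiecewisePoly n f)
    (hg : IsPiecewisePoly n g) (hfc : ContinuousOn f (Ioo 0 1)) (hgc : Continuous g)
    (hg0 : g 0 = 0) (hg1 : g 1 = 0) :
    ∫ x in Ioo (0 : ℝ) 1, deriv f x * g x = -∫ x in Ioo (0 : ℝ) 1, f x * deriv g x := by
  have hn' : (0 : ℝ) < n := by exact_mod_cast hn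
  have hI : IntervalIntegrable (fun x => deriv f x * g x + f x * deriv g x) volume 0 1 :=
    ((hf.deriv.mul hg).add (hf.mul hg.deriv)).intervalIntegrable hn
  -- The factor `f` may jump at an end point, as half-open B-splines do at 1. Near it `f` is a
  -- polynomial, hence bounded, so the zero of `g` makes the product continuous there.
  have hzero : ∀ x : ℝ, g x = 0 → ∀ s : Set ℝ, ∀ P : Polynomial ℝ,
      (∀ᶠ y in 𝓝[s] x, y ≠ x → f y = P.eval y) → ContinuousWithinAt (fun y => f y * g y) s x := by
    intro x hx s P hP
    have hc : ContinuousWithinAt (fun y => P.eval y * g y) s x :=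
      (P.continuous.mul hgc).continuousWithinAt
    refine hc.congr_of_eventuallyEq ?_ (by simp [hx])
    filter_upwards [hP] with y hy
    by_cases hyx : y = x
    · simp [hyx, hx]
    · rw [hy hyx]
  have hcont : ContinuousOn (fun x => f x * g x) (Icc 0 1) := by
    intro x hx
    rcases eq_or_lt_of_le hx.1 with rfl | h0
    · obtain ⟨P, hP⟩ := hf 0 hn
      apply hzero _ hg0 _ P
      have hlt : (0 : ℝ) < ((0 + 1 : ℕ) : ℝ) / n := by positivity
      filter_upwards [self_mem_nhdsWithin, mem_nhdsWithin_of_mem_nhds (Iio_mem_nhds hlt)]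
        with y hy hy' hne
      exact hP y ⟨by simpa using lt_of_le_of_ne hy.1 (Ne.symm hne), hy'⟩
    rcases eq_or_lt_of_le hx.2 with rfl | h1
    · obtain ⟨P, hP⟩ := hf (n - 1) (by omega)
      apply hzero _ hg1 _ P
      have hlt : ((n - 1 : ℕ) : ℝ) / n < 1 := by
        rw [div_lt_one hn']; exact_mod_cast (by omega : n - 1 < n)
      filter_upwards [self_mem_nhdsWithin, mem_nhdsWithin_of_mem_nhds (Ioi_mem_nhds hlt)]
        with y hy hy' hne
      refine hP y ⟨hy', ?_⟩
      rw [show n - 1 + 1 = n by omega, div_self hn'.ne']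
      exact lt_of_le_of_ne hy.2 hne
    · exact ((hfc.continuousAt (Ioo_mem_nhds h0 h1)).mul
        hgc.continuousAt).continuousWithinAt
  have key := integral_eq_of_hasDerivAt_off_countable_of_le (fun x => f x * g x)
    (fun x => deriv f x * g x + f x * deriv g x) zero_le_one (countable_gridPoints n) hcont
    (fun x hx => by
      obtain ⟨j, hj, hxj⟩ := exists_mem_cell hn hx.1 hx.2
      exact (hf.differentiableAt hj hxj).hasDerivAt.mul (hg.differentiableAt hj hxj).hasDerivAt)
    hI
  rw [intervalIntegral.integral_add ((hf.deriv.mul hg).intervalIntegrable hn)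
    ((hf.mul hg.deriv).intervalIntegrable hn)] at key
  rw [setIntegral_Ioo_eq, setIntegral_Ioo_eq]
  simp only [hg0, hg1, mul_zero, sub_zero] at key
  linarith

theorem sum_integral_cell (hn : 0 < n) (hf : IsPiecewisePoly n f) :
    ∫ x in Ioo (0 : ℝ) 1, f x =
      ∑ j ∈ Finset.range n, ∫ x in cell n j, f x := by
  have := intervalIntegral.sum_integral_adjacent_intervals (a := fun j : ℕ => (j : ℝ) / n) (n := n)
    (f := f) (μ := volume) fun j hj => hf.intervalIntegrable_cell hj
  have hn' : (n : ℝ) ≠ 0 := by exact_mod_cast hn.ne'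
  simp only [Nat.cast_zero, zero_div, div_self hn'] at this
  rw [setIntegral_Ioo_eq, ← this]
  refine Finset.sum_congr rfl fun j _ => ?_
  rw [intervalIntegral.integral_of_le (div_le_div_succ n j), integral_Ioc_eq_integral_Ioo, cell]

/-- Inverse inequality for piecewise affine functions. -/
theorem inverse_inequality_affine (hn : 0 < n)
    (hf : ∀ j < n, ∃ a b : ℝ, ∀ x ∈ cell n j, f x = a + b * x) :
    ∫ x in Ioo (0 : ℝ) 1, deriv f x ^ 2 ≤ 12 * n ^ 2 * ∫ x in Ioo (0 : ℝ) 1, f x ^ 2 := by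
  have hn' : (0 : ℝ) < n := by exact_mod_cast hn
  have hpp : IsPiecewisePoly n f := fun j hj => by
    obtain ⟨a, b, h⟩ := hf j hj
    exact ⟨Polynomial.C a + Polynomial.C b * Polynomial.X, fun x hx => by simp [h x hx]⟩
  rw [sum_integral_cell hn hpp.sq, sum_integral_cell hn hpp.deriv.sq, Finset.mul_sum]
  refine Finset.sum_le_sum fun j hj => ?_
  obtain ⟨a, b, h⟩ := hf j (Finset.mem_range.1 hj)
  have h1 : ∫ x in cell n j, f x ^ 2 = ∫ x in cell n j, (a + b * x) ^ 2 :=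
    setIntegral_congr_fun measurableSet_Ioo fun x hx => by simp only [h x hx]
  have h2 : ∫ x in cell n j, deriv f x ^ 2 = ∫ x in cell n j, b ^ 2 := by
    refine setIntegral_congr_fun measurableSet_Ioo fun x hx => ?_
    have : f =ᶠ[𝓝 x] fun x => a + b * x := by
      filter_upwards [(isOpen_cell n j).mem_nhds hx] with y hy using h y hy
    have hd : HasDerivAt (fun x => a + b * x) b x := by
      simpa using ((hasDerivAt_id x).const_mul b).const_add a
    simp only [this.deriv_eq, hd.deriv]
  rw [h1, h2]
  simp only [cell, ← integral_Ioc_eq_integral_Ioo]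
  rw [← intervalIntegral.integral_of_le (div_le_div_succ n j),
    ← intervalIntegral.integral_of_le (div_le_div_succ n j), intervalIntegral.integral_const]
  set s : ℝ := (j : ℝ) / n with hs
  have ht : ((j + 1 : ℕ) : ℝ) / n = s + 1 / n := by rw [hs]; push_cast; ring
  rw [ht]
  -- Expansion about the midpoint of the cell: the linear term integrates to zero, and the remaining
  -- b² h³ / 12 is the source of the constant 12.
  have hint : ∫ x in s..(s + 1 / n), (a + b * x) ^ 2 =
      (1 / n) * (a + b * (s + 1 / (2 * n))) ^ 2 + b ^ 2 * (1 / n) ^ 3 / 12 := by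
    have hF : ∀ x ∈ uIcc s (s + 1 / n), HasDerivAt
        (fun x => a ^ 2 * x + a * b * x ^ 2 + b ^ 2 * (x ^ 3 / 3)) ((a + b * x) ^ 2) x := by
      intro x _
      have e1 := (hasDerivAt_id x).const_mul (a ^ 2)
      have e2 := (hasDerivAt_pow 2 x).const_mul (a * b)
      have e3 := ((hasDerivAt_pow 3 x).div_const 3).const_mul (b ^ 2)
      refine ((e1.add e2).add e3).congr_deriv ?_
      push_cast
      ring
    rw [intervalIntegral.integral_eq_sub_of_hasDerivAt hF
      (Continuous.intervalIntegrable (by fun_prop) _ _)]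
    field_simp
    ring
  rw [hint, smul_eq_mul]
  have e : 12 * (n : ℝ) ^ 2 * (1 / n * (a + b * (s + 1 / (2 * n))) ^ 2 + b ^ 2 * (1 / n) ^ 3 / 12)
      = 12 * n * (a + b * (s + 1 / (2 * n))) ^ 2 + (s + 1 / n - s) * b ^ 2 := by
    field_simp
    ring
  rw [e]
  have : 0 ≤ 12 * n * (a + b * (s + 1 / (2 * n))) ^ 2 := by positivity
  linarith

end SplineMG
namespace SplineMG

open MeasureTheory Set Filter Topology

/-! ### B-splines over monotone knot sequences -/

variable {n : ℕ} {t : ℕ → ℝ}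

/-- The recursion reads only the k + 2 knots from index i on. This locality later identifies inner
functions of the open knot vector with uniform B-splines. -/
theorem bspline_congr {t' : ℕ → ℝ} (k i i' : ℕ) (h : ∀ j ≤ k + 1, t (i + j) = t' (i' + j)) :
    bspline t k i = bspline t' k i' := by
  induction k generalizing i i' with
  | zero =>
    funext x
    have h0 := h 0 (by omega)
    have h1 := h 1 (by omega)
    simp only [add_zero] at h0
    simp only [bspline, h0, h1]
  | succ k ih =>
    funext x
    have e1 := ih i i' fun j hj => h j (by omega)
    have e2 := ih (i + 1) (i' + 1) fun j hj => by
      simpa only [add_assoc, add_comm, add_left_comm] using h (j + 1) (by omega)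
    have h0 := h 0 (by omega)
    simp only [add_zero] at h0
    have h1 := h 1 (by omega)
    have h2 := h (k + 1) (by omega)
    have h3 := h (k + 2) (by omega)
    simp only [← add_assoc] at h2 h3
    simp only [bspline, e1, e2, h0, h1, h2, h3]

/-- A knot sequence whose members are points of the uniform grid. -/
def IsGridKnots (n : ℕ) (t : ℕ → ℝ) : Prop := ∃ m : ℕ → ℕ, ∀ i, t i = (m i : ℝ) / n

theorem IsGridKnots.bspline_zero (hn : 0 < n) (ht : IsGridKnots n t) (i j : ℕ) :
    ∃ c : ℝ, ∀ x ∈ cell n j, bspline t 0 i x = c := by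
  obtain ⟨m, hm⟩ := ht
  have hn' : (0 : ℝ) < n := by exact_mod_cast hn
  by_cases h : m i ≤ j ∧ j + 1 ≤ m (i + 1)
  · refine ⟨1, fun x hx => ?_⟩
    rw [bspline, indicator_of_mem]
    refine ⟨?_, ?_⟩
    · rw [hm]
      refine le_trans ?_ hx.1.le
      gcongr
      exact h.1
    · rw [hm]
      refine lt_of_lt_of_le hx.2 ?_
      gcongr
      exact h.2
  · refine ⟨0, fun x hx => ?_⟩
    rw [bspline, indicator_of_notMem]
    rintro ⟨h1, h2⟩
    rw [hm] at h1 h2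
    have h1 := h1.trans_lt hx.2
    have h2 := hx.1.trans h2
    rw [div_lt_div_iff_of_pos_right hn'] at h1 h2
    norm_cast at h1 h2
    omega

theorem IsGridKnots.isPiecewisePoly (hn : 0 < n) (ht : IsGridKnots n t) (k i : ℕ) :
    IsPiecewisePoly n (bspline t k i) := by
  induction k generalizing i with
  | zero =>
    intro j _
    obtain ⟨c, hc⟩ := ht.bspline_zero hn i j
    exact ⟨Polynomial.C c, fun x hx => by simp [hc x hx]⟩
  | succ k ih =>
    have lin : ∀ a b c : ℝ, IsPiecewisePoly n fun x => (a * x + b) / c := fun a b c => by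
      have := isPiecewisePoly_eval (n := n)
        ((Polynomial.C a * Polynomial.X + Polynomial.C b) * Polynomial.C (c⁻¹))
      simpa [div_eq_mul_inv] using this
    have h := ((lin 1 (-t i) (t (i + k + 1) - t i)).mul (ih i)).add
      ((lin (-1) (t (i + k + 2)) (t (i + k + 2) - t (i + 1))).mul (ih (i + 1)))
    convert h using 2 with x
    simp only [bspline]
    ring

theorem IsGridKnots.bspline_one (hn : 0 < n) (ht : IsGridKnots n t) (i j : ℕ) :
    ∃ a b : ℝ, ∀ x ∈ cell n j, bspline t 1 i x = a + b * x := by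
  obtain ⟨c, hc⟩ := ht.bspline_zero hn i j
  obtain ⟨d, hd⟩ := ht.bspline_zero hn (i + 1) j
  refine ⟨-t i * c / (t (i + 1) - t i) + t (i + 2) * d / (t (i + 2) - t (i + 1)),
    c / (t (i + 1) - t i) - d / (t (i + 2) - t (i + 1)), fun x hx => ?_⟩
  simp only [bspline, add_zero] at hc hd ⊢
  rw [hc x hx, hd x hx]
  ring

theorem bspline_eq_zero_of_lt (ht : Monotone t) (k i : ℕ) {x : ℝ} (hx : x < t i) :
    bspline t k i x = 0 := by
  induction k generalizing i with
  | zero => exact indicator_of_notMem (fun h => absurd h.1 (not_le.2 hx)) _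
  | succ k ih =>
    simp only [bspline, ih i hx, ih (i + 1) (hx.trans_le (ht (by omega))), mul_zero, add_zero]

theorem bspline_eq_zero_of_le (ht : Monotone t) (k i : ℕ) {x : ℝ} (hx : t (i + k + 1) ≤ x) :
    bspline t k i x = 0 := by
  induction k generalizing i with
  | zero => exact indicator_of_notMem (fun h => absurd h.2 (not_lt.2 hx)) _
  | succ k ih =>
    have h1 := ih i ((ht (by omega)).trans hx)
    have h2 := ih (i + 1) (by convert hx using 2; omega)
    simp only [bspline, h1, h2, mul_zero, add_zero]

/-- On the first knot interval of the support the second summand of the recursion vanishes, leaving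
a product of positive factors. Linear independence rests on this. -/
theorem bspline_pos (ht : StrictMono t) (k i : ℕ) {x : ℝ} (hx : x ∈ Ioo (t i) (t (i + 1))) :
    0 < bspline t k i x := by
  induction k with
  | zero =>
    rw [bspline, indicator_of_mem (show x ∈ Ico _ _ from ⟨hx.1.le, hx.2⟩)]
    exact one_pos
  | succ k ih =>
    rw [bspline, bspline_eq_zero_of_lt ht.monotone k (i + 1) hx.2, mul_zero, add_zero]
    have h1 : t i < t (i + k + 1) := ht (by omega)
    have := hx.1
    exact mul_pos (div_pos (by linarith) (by linarith)) ih

/-- Near x the hat function is the positive part of a ramp or, at the middle knot, the minimum of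
two ramps. Only at the middle knot must coinciding knots be excluded. -/
theorem continuousAt_bspline_one (ht : Monotone t) (i : ℕ) {x : ℝ}
    (hx : ∀ j, t j = t (j + 1) → x ≠ t j) : ContinuousAt (bspline t 1 i) x := by
  have hab : t i ≤ t (i + 1) := ht (by omega)
  have hbc : t (i + 1) ≤ t (i + 2) := ht (by omega)
  have hxa := hx i
  have hxb := hx (i + 1)
  have e : bspline t 1 i = fun x =>
      (x - t i) / (t (i + 1) - t i) * (Ico (t i) (t (i + 1))).indicator (fun _ => (1 : ℝ)) x +
      (t (i + 2) - x) / (t (i + 2) - t (i + 1)) *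
        (Ico (t (i + 1)) (t (i + 2))).indicator (fun _ => (1 : ℝ)) x := by
    funext x
    simp only [bspline, add_zero]
  rw [e]
  simp only [show i + 1 + 1 = i + 2 from rfl] at hxb
  generalize t i = a at *
  generalize t (i + 1) = b at *
  generalize t (i + 2) = c at *
  rcases lt_trichotomy x b with h | rfl | h
  · have : ContinuousAt (fun x => max 0 ((x - a) / (b - a))) x := by fun_prop
    refine this.congr ?_
    filter_upwards [Iio_mem_nhds h] with y (hy : y < b)
    rw [indicator_of_notMem (s := Ico b c) fun h => absurd h.1 (not_le.2 hy), mul_zero, add_zero]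
    by_cases hya : a ≤ y
    · rw [indicator_of_mem (show y ∈ Ico _ _ from ⟨hya, hy⟩), mul_one, max_eq_right]
      exact div_nonneg (by linarith) (by linarith)
    · rw [indicator_of_notMem fun h => hya h.1, mul_zero, max_eq_left]
      exact div_nonpos_of_nonpos_of_nonneg (by linarith) (by linarith)
  · have hab' : a < x := lt_of_le_of_ne hab fun h => hxa h h.symm
    have hbc' : x < c := lt_of_le_of_ne hbc fun h => hxb h rfl
    have : ContinuousAt (fun y => min ((y - a) / (x - a)) ((c - y) / (c - x))) x := by fun_prop
    refine this.congr ?_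
    filter_upwards [Ioo_mem_nhds hab' hbc'] with y hy
    have h1 : 0 < x - a := by linarith
    have h2 : 0 < c - x := by linarith
    by_cases hyx : y < x
    · rw [indicator_of_mem (show y ∈ Ico _ _ from ⟨hy.1.le, hyx⟩),
        indicator_of_notMem fun h => absurd h.1 (not_le.2 hyx), mul_one, mul_zero, add_zero,
        min_eq_left]
      refine ((div_le_one h1).2 (by linarith)).trans ((one_le_div h2).2 (by linarith))
    · rw [indicator_of_notMem fun h => hyx h.2,
        indicator_of_mem (show y ∈ Ico _ _ from ⟨not_lt.1 hyx, hy.2⟩), mul_one, mul_zero, zero_add, min_eq_right]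
      refine ((div_le_one h2).2 (by linarith)).trans ((one_le_div h1).2 (by linarith))
  · have : ContinuousAt (fun x => max 0 ((c - x) / (c - b))) x := by fun_prop
    refine this.congr ?_
    filter_upwards [Ioi_mem_nhds h] with y (hy : b < y)
    rw [indicator_of_notMem (s := Ico a b) fun h => absurd h.2 (not_lt.2 hy.le), mul_zero,
      zero_add]
    by_cases hya : y < c
    · rw [indicator_of_mem (show y ∈ Ico _ _ from ⟨hy.le, hya⟩), mul_one, max_eq_right]
      exact div_nonneg (by linarith) (by linarith)
    · rw [indicator_of_notMem fun h => hya h.2, mul_zero, max_eq_left]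
      exact div_nonpos_of_nonpos_of_nonneg (by linarith) (by linarith)

/-- B-splines of positive degree are continuous away from multiple knots. -/
theorem continuousAt_bspline (ht : Monotone t) (k i : ℕ) {x : ℝ}
    (hx : ∀ j, t j = t (j + 1) → x ≠ t j) : ContinuousAt (bspline t (k + 1) i) x := by
  induction k generalizing i with
  | zero => exact continuousAt_bspline_one ht i hx
  | succ k ih =>
    have h1 := ih i
    have h2 := ih (i + 1)
    have e : bspline t (k + 1 + 1) i = fun x =>
        (x - t i) / (t (i + (k + 1) + 1) - t i) * bspline t (k + 1) i x +
        (t (i + (k + 1) + 2) - x) / (t (i + (k + 1) + 2) - t (i + 1)) *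
          bspline t (k + 1) (i + 1) x := rfl
    rw [e]
    fun_prop

/-! ### Splines over uniform knots -/

/-- The uniform knots `0, 1/n, 2/n, …`. -/
noncomputable def uniformKnot (n j : ℕ) : ℝ := (j : ℝ) / n

theorem strictMono_uniformKnot (hn : 0 < n) : StrictMono (uniformKnot n) := fun i j h => by
  have hn' : (0 : ℝ) < n := by exact_mod_cast hn
  unfold uniformKnot
  gcongr

theorem isGridKnots_uniformKnot : IsGridKnots n (uniformKnot n) := ⟨id, fun _ => rfl⟩

theorem hasDerivAt_bspline_uniform (hn : 0 < n) (k i j : ℕ) {x : ℝ} (hx : x ∈ cell n j) :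
    HasDerivAt (bspline (uniformKnot n) (k + 1) i)
      (n * (bspline (uniformKnot n) k i x - bspline (uniformKnot n) k (i + 1) x)) x := by
  have hn' : (0 : ℝ) < n := by exact_mod_cast hn
  have step : ∀ k i : ℕ, ∀ d e : ℝ, HasDerivAt (bspline (uniformKnot n) k i) d x →
      HasDerivAt (bspline (uniformKnot n) k (i + 1)) e x →
      HasDerivAt (bspline (uniformKnot n) (k + 1) i)
        (n / (k + 1) * (bspline (uniformKnot n) k i x - bspline (uniformKnot n) k (i + 1) x
          + (x - i / n) * d + ((i + k + 2) / n - x) * e)) x := by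
    intro k i d e hd he
    have h1 := (((hasDerivAt_id x).sub_const ((i : ℝ) / n)).mul hd).const_mul ((n : ℝ) / (k + 1))
    have h2 := (((hasDerivAt_id x).const_sub ((i + k + 2 : ℝ) / n)).mul he).const_mul
      ((n : ℝ) / (k + 1))
    have hk : (k : ℝ) + 1 ≠ 0 := by positivity
    refine ((h1.add h2).congr_of_eventuallyEq (Eventually.of_forall fun y => ?_)).congr_deriv ?_
    · simp only [bspline, uniformKnot, Pi.add_apply, Pi.mul_apply, id]
      push_cast
      have e1 : ((i : ℝ) + k + 1) / n - i / n = (k + 1) / n := by ring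
      have e2 : ((i : ℝ) + k + 2) / n - (i + 1) / n = (k + 1) / n := by ring
      rw [e1, e2]
      field_simp
    · simp only [id]
      ring
  induction k generalizing i with
  | zero =>
    have hconst : ∀ i, HasDerivAt (bspline (uniformKnot n) 0 i) 0 x := fun i => by
      obtain ⟨c, hc⟩ := isGridKnots_uniformKnot.bspline_zero hn i j
      refine (hasDerivAt_const x c).congr_of_eventuallyEq ?_
      filter_upwards [(isOpen_cell n j).mem_nhds hx] with y hy using hc y hy
    refine (step 0 i 0 0 (hconst _) (hconst _)).congr_deriv ?_
    simp
  | succ k ih =>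
    -- With the derivatives in degree k + 1 known, the two product-rule terms recombine through the
    -- recursion into k + 1 copies of the difference already present. The total factor k + 2 cancels
    -- the denominator in `step`.
    refine (step (k + 1) i _ _ (ih i) (ih (i + 1))).congr_deriv ?_
    simp only [bspline, uniformKnot]
    generalize bspline _ k i x = A
    generalize bspline _ k (i + 1) x = B
    generalize bspline _ k (i + 1 + 1) x = C
    push_cast
    have hk : (k : ℝ) + 1 ≠ 0 := by positivity
    have hk2 : (k : ℝ) + 1 + 1 ≠ 0 := by positivity
    have e1 : ((i : ℝ) + k + 1) / n - i / n = (k + 1) / n := by ring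
    have e2 : ((i : ℝ) + k + 2) / n - (i + 1) / n = (k + 1) / n := by ring
    have e3 : ((i : ℝ) + 1 + k + 1) / n - (i + 1) / n = (k + 1) / n := by ring
    have e4 : ((i : ℝ) + 1 + k + 2) / n - (i + 1 + 1) / n = (k + 1) / n := by ring
    rw [e1, e2, e3, e4]
    field_simp
    ring

/-! ### Compactly supported splines: boundary values and derivatives -/

/-- The span of the uniform B-splines of degree `k` supported in `[0,1]`. -/
def innerSplines (n k : ℕ) : Submodule ℝ (ℝ → ℝ) :=
  Submodule.span ℝ {f | ∃ i, i + k + 1 ≤ n ∧ f = bspline (uniformKnot n) k i}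

variable {k : ℕ} {v : ℝ → ℝ}

theorem continuous_of_mem_innerSplines (hn : 0 < n) (hv : v ∈ innerSplines n (k + 1)) :
    Continuous v := by
  induction hv using Submodule.span_induction with
  | mem f hf =>
    obtain ⟨i, -, rfl⟩ := hf
    exact continuous_iff_continuousAt.2 fun x =>
      continuousAt_bspline (strictMono_uniformKnot hn).monotone k i fun j h =>
        absurd h (strictMono_uniformKnot hn (Nat.lt_succ_self j)).ne
  | zero => exact continuous_const
  | add f g _ _ hf hg => exact hf.add hg
  | smul a f _ hf => exact hf.const_smul a

theorem isPiecewisePoly_of_mem_innerSplines (hn : 0 < n) (hv : v ∈ innerSplines n k) :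
    IsPiecewisePoly n v := by
  induction hv using Submodule.span_induction with
  | mem f hf =>
    obtain ⟨i, -, rfl⟩ := hf
    exact isGridKnots_uniformKnot.isPiecewisePoly hn k i
  | zero => exact isPiecewisePoly_const 0
  | add f g _ _ hf hg => exact hf.add hg
  | smul a f _ hf => exact hf.const_mul a

theorem apply_one_of_mem_innerSplines (hn : 0 < n) (hv : v ∈ innerSplines n k) : v 1 = 0 := by
  induction hv using Submodule.span_induction with
  | mem f hf =>
    obtain ⟨i, hi, rfl⟩ := hf
    apply bspline_eq_zero_of_le (strictMono_uniformKnot hn).monotone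
    have hn' : (0 : ℝ) < n := by exact_mod_cast hn
    rw [uniformKnot, div_le_one hn']
    exact_mod_cast hi
  | zero => rfl
  | add f g _ _ hf hg => simp [hf, hg]
  | smul a f _ hf => simp [hf]

/-- The value follows by continuity from the left of 0. Degree zero must be excluded, since the
indicator of [0, 1/n) equals 1 at 0; at the right end point half-openness makes every degree vanish.
-/
theorem apply_zero_of_mem_innerSplines (hn : 0 < n) (hv : v ∈ innerSplines n (k + 1)) :
    v 0 = 0 := by
  have hneg : ∀ x < 0, v x = 0 := by
    intro x hx
    induction hv using Submodule.span_induction with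
    | mem f hf =>
      obtain ⟨i, hi, rfl⟩ := hf
      apply bspline_eq_zero_of_lt (strictMono_uniformKnot hn).monotone
      exact hx.trans_le (by unfold uniformKnot; positivity)
    | zero => rfl
    | add f g _ _ hf hg => simp [hf, hg]
    | smul a f _ hf => simp [hf]
  have h1 : Tendsto v (𝓝[<] 0) (𝓝 (v 0)) :=
    (continuous_of_mem_innerSplines hn hv).continuousAt.mono_left nhdsWithin_le_nhds
  have h2 : Tendsto v (𝓝[<] 0) (𝓝 0) :=
    tendsto_const_nhds.congr' (by filter_upwards [self_mem_nhdsWithin] with x hx using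
      (hneg x hx).symm)
  exact tendsto_nhds_unique h1 h2

/-- Differentiation gives a difference of neighbours i and i + 1; the degree drops by one, so both
supports still fit into [0,1]. -/
theorem exists_deriv_mem_innerSplines (hn : 0 < n) (hv : v ∈ innerSplines n (k + 1)) :
    ∃ w ∈ innerSplines n k, ∀ j, ∀ x ∈ cell n j, HasDerivAt v (w x) x := by
  induction hv using Submodule.span_induction with
  | mem f hf =>
    obtain ⟨i, hi, rfl⟩ := hf
    refine ⟨(n : ℝ) • (bspline (uniformKnot n) k i - bspline (uniformKnot n) k (i + 1)), ?_, ?_⟩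
    · exact Submodule.smul_mem _ _ (Submodule.sub_mem _
        (Submodule.subset_span ⟨i, by omega, rfl⟩)
        (Submodule.subset_span ⟨i + 1, by omega, rfl⟩))
    · exact fun j x hx => hasDerivAt_bspline_uniform hn k i j hx
  | zero => exact ⟨0, Submodule.zero_mem _, fun j x _ => hasDerivAt_const x 0⟩
  | add f g _ _ hf hg =>
    obtain ⟨a, ha, ha'⟩ := hf
    obtain ⟨b, hb, hb'⟩ := hg
    exact ⟨a + b, Submodule.add_mem _ ha hb, fun j x hx => (ha' j x hx).add (hb' j x hx)⟩
  | smul c f _ hf =>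
    obtain ⟨a, ha, ha'⟩ := hf
    exact ⟨c • a, Submodule.smul_mem _ c ha, fun j x hx => (ha' j x hx).const_smul c⟩

theorem affine_of_mem_innerSplines (hn : 0 < n) (hv : v ∈ innerSplines n 1) (j : ℕ) :
    ∃ a b : ℝ, ∀ x ∈ cell n j, v x = a + b * x := by
  induction hv using Submodule.span_induction with
  | mem f hf =>
    obtain ⟨i, -, rfl⟩ := hf
    exact isGridKnots_uniformKnot.bspline_one hn i j
  | zero => exact ⟨0, 0, fun x _ => by simp⟩
  | add f g _ _ hf hg =>
    obtain ⟨a, b, h⟩ := hf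
    obtain ⟨a', b', h'⟩ := hg
    exact ⟨a + a', b + b', fun x hx => by rw [Pi.add_apply, h x hx, h' x hx]; ring⟩
  | smul c f _ hf =>
    obtain ⟨a, b, h⟩ := hf
    exact ⟨c * a, c * b, fun x hx => by rw [Pi.smul_apply, h x hx, smul_eq_mul]; ring⟩

/-! ### Inverse and energy estimates independent of the degree -/

/-- The pairing of a spline with the derivative of a compactly supported spline, estimated by
means of an inverse inequality for the derivative. -/
theorem neg_integral_mul_deriv_le {u w : ℝ → ℝ} (hn : 0 < n) (hu : IsPiecewisePoly n u)
    (hw : IsPiecewisePoly n w)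
    (hinv : ∫ x in Ioo (0 : ℝ) 1, deriv w x ^ 2 ≤ 12 * n ^ 2 * ∫ x in Ioo (0 : ℝ) 1, w x ^ 2) :
    -∫ x in Ioo (0 : ℝ) 1, u x * deriv w x ≤
      6 * n ^ 2 * (∫ x in Ioo (0 : ℝ) 1, u x ^ 2) + 2⁻¹ * ∫ x in Ioo (0 : ℝ) 1, w x ^ 2 := by
  have hn' : (0 : ℝ) < n := by exact_mod_cast hn
  have h1 : -∫ x in Ioo (0 : ℝ) 1, u x * deriv w x ≤
      ∫ x in Ioo (0 : ℝ) 1, (6 * n ^ 2 * u x ^ 2 + (24 * (n : ℝ) ^ 2)⁻¹ * deriv w x ^ 2) := by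
    rw [← integral_neg]
    refine integral_mono ?_ ?_ fun x => ?_
    · exact ((hu.mul hw.deriv).integrableOn hn).neg
    · exact ((hu.sq.const_mul _).add (hw.deriv.sq.const_mul _)).integrableOn hn
    -- Young's inequality as a completed square. The weight 1/(24 n²) is chosen so that `hinv` turns
    -- the derivative term into exactly half of ‖w‖², which can later be absorbed.
    · have : 0 ≤ (24 * (n : ℝ) ^ 2)⁻¹ * (12 * n ^ 2 * u x + deriv w x) ^ 2 := by positivity
      have e : (24 * (n : ℝ) ^ 2)⁻¹ * (12 * n ^ 2 * u x + deriv w x) ^ 2 =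
          6 * n ^ 2 * u x ^ 2 + (24 * (n : ℝ) ^ 2)⁻¹ * deriv w x ^ 2 + u x * deriv w x := by
        field_simp
        ring
      simp only
      linarith
  rw [integral_add ((hu.sq.const_mul _).integrableOn hn)
    ((hw.deriv.sq.const_mul _).integrableOn hn), integral_const_mul, integral_const_mul] at h1
  have h2 := mul_le_mul_of_nonneg_left hinv (by positivity : 0 ≤ (24 * (n : ℝ) ^ 2)⁻¹)
  have e : (24 * (n : ℝ) ^ 2)⁻¹ * (12 * n ^ 2 * ∫ x in Ioo (0 : ℝ) 1, w x ^ 2) =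
      2⁻¹ * ∫ x in Ioo (0 : ℝ) 1, w x ^ 2 := by
    field_simp
    ring
  linarith

/-- The degree-robust inverse inequality for compactly supported splines of maximal smoothness. -/
theorem inverse_inequality (hn : 0 < n) (hv : v ∈ innerSplines n (k + 1)) :
    ∫ x in Ioo (0 : ℝ) 1, deriv v x ^ 2 ≤ 12 * n ^ 2 * ∫ x in Ioo (0 : ℝ) 1, v x ^ 2 := by
  induction k generalizing v with
  | zero => exact inverse_inequality_affine hn fun j _ => affine_of_mem_innerSplines hn hv j
  | succ k ih =>
    obtain ⟨w, hw, hvw⟩ := exists_deriv_mem_innerSplines hn hv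
    have hvp := isPiecewisePoly_of_mem_innerSplines hn hv
    have hwp := isPiecewisePoly_of_mem_innerSplines hn hw
    -- Here w = v', so ‖w‖² = (v',w) = -(v,w') ≤ 6n²‖v‖² + ½‖w‖², where the induction hypothesis is
    -- applied to w. Absorbing the last term restores the constant 12.
    have h1 := integral_deriv_mul_eq_neg hn hvp hwp
      (continuous_of_mem_innerSplines hn hv).continuousOn (continuous_of_mem_innerSplines hn hw)
      (apply_zero_of_mem_innerSplines hn hw) (apply_one_of_mem_innerSplines hn hw)
    have h2 := neg_integral_mul_deriv_le hn hvp hwp (ih hw)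
    have e1 : ∫ x in Ioo (0 : ℝ) 1, deriv v x * w x = ∫ x in Ioo (0 : ℝ) 1, w x ^ 2 :=
      setIntegral_congr_cell hn fun j _ x hx => by rw [(hvw j x hx).deriv, sq]
    have e2 : ∫ x in Ioo (0 : ℝ) 1, deriv v x ^ 2 = ∫ x in Ioo (0 : ℝ) 1, w x ^ 2 :=
      setIntegral_congr_cell hn fun j _ x hx => by rw [(hvw j x hx).deriv]
    rw [e2]
    linarith

/-- Energy estimate for the orthogonal projection to the compactly supported splines. -/
theorem energy_le {u : ℝ → ℝ} (hn : 0 < n) (hu : IsPiecewisePoly n u)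
    (huc : ContinuousOn u (Ioo 0 1)) (hv : v ∈ innerSplines n (k + 2))
    (horth : (∫ x in Ioo (0 : ℝ) 1, deriv v x ^ 2) + (∫ x in Ioo (0 : ℝ) 1, v x ^ 2) =
      (∫ x in Ioo (0 : ℝ) 1, deriv u x * deriv v x) + ∫ x in Ioo (0 : ℝ) 1, u x * v x) :
    (∫ x in Ioo (0 : ℝ) 1, deriv v x ^ 2) + (∫ x in Ioo (0 : ℝ) 1, v x ^ 2) ≤
      13 * n ^ 2 * ∫ x in Ioo (0 : ℝ) 1, u x ^ 2 := by
  obtain ⟨w, hw, hvw⟩ := exists_deriv_mem_innerSplines hn hv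
  have hvp := isPiecewisePoly_of_mem_innerSplines hn hv
  have hwp := isPiecewisePoly_of_mem_innerSplines hn hw
  have h1 := integral_deriv_mul_eq_neg hn hu hwp huc (continuous_of_mem_innerSplines hn hw)
    (apply_zero_of_mem_innerSplines hn hw) (apply_one_of_mem_innerSplines hn hw)
  have h2 := neg_integral_mul_deriv_le hn hu hwp (inverse_inequality hn hw)
  have e1 : ∫ x in Ioo (0 : ℝ) 1, deriv u x * deriv v x = ∫ x in Ioo (0 : ℝ) 1, deriv u x * w x :=
    setIntegral_congr_cell hn fun j _ x hx => by rw [(hvw j x hx).deriv]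
  have e2 : ∫ x in Ioo (0 : ℝ) 1, deriv v x ^ 2 = ∫ x in Ioo (0 : ℝ) 1, w x ^ 2 :=
    setIntegral_congr_cell hn fun j _ x hx => by rw [(hvw j x hx).deriv]
  have h3 : ∫ x in Ioo (0 : ℝ) 1, u x * v x ≤
      ∫ x in Ioo (0 : ℝ) 1, (2⁻¹ * u x ^ 2 + 2⁻¹ * v x ^ 2) := by
    refine integral_mono ((hu.mul hvp).integrableOn hn)
      (((hu.sq.const_mul _).add (hvp.sq.const_mul _)).integrableOn hn) fun x => ?_
    simp only
    nlinarith [sq_nonneg (u x - v x)]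
  rw [integral_add ((hu.sq.const_mul _).integrableOn hn)
    ((hvp.sq.const_mul _).integrableOn hn), integral_const_mul, integral_const_mul] at h3
  have hU : 0 ≤ ∫ x in Ioo (0 : ℝ) 1, u x ^ 2 := integral_nonneg fun x => sq_nonneg _
  have hn1 : (1 : ℝ) ≤ n ^ 2 := by exact_mod_cast Nat.one_le_pow _ _ hn
  -- The halves of ‖v'‖² and ‖v‖² are absorbed on the left; doubling leaves (12n² + 1)‖u‖², and 1 ≤
  -- n².
  nlinarith [mul_le_mul_of_nonneg_right hn1 hU]

end SplineMG
namespace SplineMG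

open MeasureTheory Set Filter Topology Matrix

/-! ### The Schur complement as an energy of discrete harmonic extensions -/

section Schur

variable {ι : Type*} [Fintype ι] [DecidableEq ι]

/-- The vector `u` minus its discrete harmonic extension from the indices in `P`. -/
theorem exists_schur_decomposition (A : Matrix ι ι ℝ) (hA : A.transpose = A) (P : ι → Prop)
    [DecidablePred P] (hII : (A.toBlock (fun i => ¬ P i) (fun i => ¬ P i)).PosDef) (u : ι → ℝ) :
    ∃ v : ι → ℝ, (∀ i, P i → v i = 0) ∧ v ⬝ᵥ A *ᵥ v = v ⬝ᵥ A *ᵥ u ∧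
      u ⬝ᵥ A *ᵥ u = u ⬝ᵥ (Matrix.reindex (Equiv.sumCompl P) (Equiv.sumCompl P)
        (Matrix.fromBlocks (A.toBlock P P - (A.toBlock (fun i => ¬ P i) P).transpose *
          (A.toBlock (fun i => ¬ P i) (fun i => ¬ P i))⁻¹ * A.toBlock (fun i => ¬ P i) P)
          0 0 0)) *ᵥ u + v ⬝ᵥ A *ᵥ v := by
  set D := A.toBlock (fun i => ¬ P i) (fun i => ¬ P i) with hD
  set B := A.toBlock (fun i => ¬ P i) P with hB
  set E := A.toBlock P P with hE
  have hDu : IsUnit D.det := (Matrix.isUnit_iff_isUnit_det _).1 hII.isUnit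
  have hDt : D.transpose = D := by
    ext i j
    exact congrFun (congrFun hA i.1) j.1
  have hblock : A.submatrix (Equiv.sumCompl P) (Equiv.sumCompl P) =
      Matrix.fromBlocks E B.transpose B D := by
    ext (i | i) (j | j)
    · rfl
    · exact congrFun (congrFun hA j.1) i.1
    · rfl
    · rfl
  have hform : ∀ (F : Matrix ι ι ℝ) (x y : ι → ℝ), x ⬝ᵥ F *ᵥ y =
      (x ∘ Equiv.sumCompl P) ⬝ᵥ F.submatrix (Equiv.sumCompl P) (Equiv.sumCompl P) *ᵥ
        (y ∘ Equiv.sumCompl P) := by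
    intro F x y
    rw [Matrix.submatrix_mulVec_equiv, comp_equiv_dotProduct_comp_equiv]
    simp [Function.comp_assoc]
  have hsplit : ∀ x : ι → ℝ, x ∘ Equiv.sumCompl P =
      Sum.elim (fun i => x i.1) (fun i => x i.1) := by
    intro x
    ext (i | i) <;> rfl
  set a : {i // P i} → ℝ := fun i => u i.1 with ha
  set b : {i // ¬ P i} → ℝ := fun i => u i.1 with hb
  set z := D⁻¹ *ᵥ (B *ᵥ a) with hz
  have hDz : D *ᵥ z = B *ᵥ a := by
    rw [hz, Matrix.mulVec_mulVec, Matrix.mul_nonsing_inv _ hDu, Matrix.one_mulVec]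
  have hsym : z ⬝ᵥ D *ᵥ b = (B *ᵥ a) ⬝ᵥ b := by
    rw [Matrix.dotProduct_mulVec, ← Matrix.mulVec_transpose, hDt, hDz]
  have hBt : ∀ w, a ⬝ᵥ B.transpose *ᵥ w = (B *ᵥ a) ⬝ᵥ w := by
    intro w
    rw [Matrix.dotProduct_mulVec, Matrix.vecMul_transpose]
  -- The discrete harmonic extension of a has inner part -z, so subtracting it from u leaves 0 on
  -- `P` and b + z elsewhere.
  let v : ι → ℝ := fun i => if h : P i then 0 else (b + z) ⟨i, h⟩
  have hv : v ∘ Equiv.sumCompl P = Sum.elim (0 : {i // P i} → ℝ) (b + z) := by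
    ext (i | i)
    · simp [v, i.2]
    · simp [v, i.2]
  refine ⟨v, fun i hi => by simp [v, hi], ?_, ?_⟩
  · rw [hform, hform, hv, hsplit u, hblock]
    simp only [Matrix.fromBlocks_mulVec, Sum.elim_comp_inl, Sum.elim_comp_inr,
      sumElim_dotProduct_sumElim, zero_dotProduct, zero_add, Matrix.mulVec_zero, Matrix.mulVec_add,
      hDz, ← ha, ← hb]
    rw [add_comm (B *ᵥ a)]
  · rw [hform, hform, hform A v, hv, hsplit u, hblock]
    simp only [Matrix.reindex_apply, Matrix.submatrix_submatrix, Equiv.symm_comp_self,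
      Matrix.submatrix_id_id]
    simp only [Matrix.fromBlocks_mulVec, Sum.elim_comp_inl, Sum.elim_comp_inr,
      sumElim_dotProduct_sumElim, zero_dotProduct, zero_add, Matrix.mulVec_zero, Matrix.mulVec_add,
      hDz, ← ha, ← hb, Matrix.zero_mulVec, add_zero, dotProduct_zero, Matrix.sub_mulVec,
      ← Matrix.mulVec_mulVec, ← hz, hBt, hsym, dotProduct_add, add_dotProduct, dotProduct_sub]
    rw [dotProduct_comm b (B *ᵥ a), dotProduct_comm z (B *ᵥ a)]
    ring

end Schur

/-! ### The Galerkin matrices -/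

variable {p n : ℕ}

/-- The spline with coefficient vector `u`. -/
noncomputable def splineOf (p n : ℕ) (u : Fin (n + p) → ℝ) (x : ℝ) : ℝ :=
  ∑ i, u i * basisFun p n i x

theorem isGridKnots_knot (p n : ℕ) : IsGridKnots n (knot p n) :=
  ⟨fun i => min (i - p) n, fun _ => rfl⟩

theorem monotone_knot (p n : ℕ) : Monotone (knot p n) := fun i j h => by
  unfold knot
  gcongr

theorem isPiecewisePoly_basisFun (hn : 0 < n) (i : Fin (n + p)) :
    IsPiecewisePoly n (basisFun p n i) :=
  (isGridKnots_knot p n).isPiecewisePoly hn p i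

theorem isPiecewisePoly_splineOf (hn : 0 < n) (u : Fin (n + p) → ℝ) :
    IsPiecewisePoly n (splineOf p n u) :=
  IsPiecewisePoly.sum _ fun i _ => (isPiecewisePoly_basisFun hn i).const_mul (u i)

/-- The open knot vector repeats knots only at 0 and 1, outside the open interval. -/
theorem continuousAt_basisFun (hn : 0 < n) (hp : 1 ≤ p) (i : Fin (n + p)) {x : ℝ}
    (hx : x ∈ Ioo (0 : ℝ) 1) : ContinuousAt (basisFun p n i) x := by
  have hn' : (0 : ℝ) < n := by exact_mod_cast hn
  obtain ⟨k, rfl⟩ : ∃ k, p = k + 1 := ⟨p - 1, by omega⟩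
  refine continuousAt_bspline (monotone_knot _ n) k i fun j hj hxj => ?_
  unfold knot at hj hxj
  rw [div_left_inj' hn'.ne', Nat.cast_inj] at hj
  rcases (by omega : min (j - (k + 1)) n = 0 ∨ min (j - (k + 1)) n = n) with h | h
  · rw [h] at hxj
    simp [hxj] at hx
  · rw [h, div_self hn'.ne'] at hxj
    simp [hxj] at hx

theorem continuousOn_splineOf (hn : 0 < n) (hp : 1 ≤ p) (u : Fin (n + p) → ℝ) :
    ContinuousOn (splineOf p n u) (Ioo 0 1) := by
  unfold splineOf
  exact continuousOn_finsetSum _ fun i _ =>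
    (fun x hx => ((continuousAt_basisFun hn hp i hx).const_mul (u i)).continuousWithinAt)

/-- For p ≤ i < n the knots i, …, i + p + 1 meet neither truncation in `knot`: the subtraction is
exact and the minimum with n has no effect. -/
theorem basisFun_eq_uniform (i : Fin (n + p)) (hi : ¬ IsBoundary p n i) :
    basisFun p n i = bspline (uniformKnot n) p (i - p) := by
  unfold IsBoundary at hi
  push Not at hi
  refine bspline_congr _ _ _ fun j hj => ?_
  unfold knot uniformKnot
  congr 2
  omega

theorem splineOf_mem_innerSplines (v : Fin (n + p) → ℝ) (hv : ∀ i, IsBoundary p n i → v i = 0) :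
    splineOf p n v ∈ innerSplines n p := by
  have e : splineOf p n v = ∑ i, v i • basisFun p n i := by
    ext x
    simp [splineOf]
  rw [e]
  refine Submodule.sum_mem _ fun i _ => ?_
  by_cases hi : IsBoundary p n i
  · simp [hv i hi]
  · refine Submodule.smul_mem _ _ (Submodule.subset_span ⟨i - p, ?_, basisFun_eq_uniform i hi⟩)
    unfold IsBoundary at hi
    omega

theorem deriv_splineOf (hn : 0 < n) (u : Fin (n + p) → ℝ) {j : ℕ} (hj : j < n) {x : ℝ}
    (hx : x ∈ cell n j) :
    deriv (splineOf p n u) x = ∑ i, u i * deriv (basisFun p n i) x := by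
  have := HasDerivAt.fun_sum (u := Finset.univ) (A := fun i x => u i * basisFun p n i x)
    (A' := fun i => u i * deriv (basisFun p n i) x) (x := x) fun i _ =>
    (((isPiecewisePoly_basisFun hn i).differentiableAt hj hx).hasDerivAt.const_mul (u i))
  exact this.deriv

theorem gram_form {m : ℕ} {F : Fin m → ℝ → ℝ} (hn : 0 < n) (hF : ∀ i, IsPiecewisePoly n (F i))
    (u v : Fin m → ℝ) :
    u ⬝ᵥ (Matrix.of fun i j => ∫ x in Ioo (0 : ℝ) 1, F i x * F j x) *ᵥ v =
      ∫ x in Ioo (0 : ℝ) 1, (∑ i, u i * F i x) * ∑ i, v i * F i x := by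
  have e : ∀ x, (∑ i, u i * F i x) * (∑ i, v i * F i x) =
      ∑ i, ∑ j, (u i * v j) * (F i x * F j x) := fun x => by
    rw [Finset.sum_mul_sum]
    exact Finset.sum_congr rfl fun i _ => Finset.sum_congr rfl fun j _ => by ring
  have hI : ∀ i j, IsPiecewisePoly n fun x => (u i * v j) * (F i x * F j x) := fun i j =>
    ((hF i).mul (hF j)).const_mul _
  simp only [e]
  rw [integral_finsetSum _ fun i _ => (IsPiecewisePoly.sum _ fun j _ => hI i j).integrableOn hn]
  simp only [dotProduct, Matrix.mulVec, Matrix.of_apply, Finset.mul_sum]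
  refine Finset.sum_congr rfl fun i _ => ?_
  rw [integral_finsetSum _ fun j _ => (hI i j).integrableOn hn]
  refine Finset.sum_congr rfl fun j _ => ?_
  rw [integral_const_mul]
  ring

theorem massMatrix_form (hn : 0 < n) (u v : Fin (n + p) → ℝ) :
    u ⬝ᵥ massMatrix p n *ᵥ v =
      ∫ x in Ioo (0 : ℝ) 1, splineOf p n u x * splineOf p n v x :=
  gram_form hn (fun i => isPiecewisePoly_basisFun hn i) u v

theorem gradMatrix_form (hn : 0 < n) (u v : Fin (n + p) → ℝ) :
    u ⬝ᵥ gradMatrix p n *ᵥ v =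
      ∫ x in Ioo (0 : ℝ) 1, deriv (splineOf p n u) x * deriv (splineOf p n v) x := by
  rw [gradMatrix, gram_form hn fun i => (isPiecewisePoly_basisFun hn i).deriv]
  exact setIntegral_congr_cell hn fun j hj x hx => by
    rw [deriv_splineOf hn u hj hx, deriv_splineOf hn v hj hx]

theorem stiffnessMatrix_form (hn : 0 < n) (u v : Fin (n + p) → ℝ) :
    u ⬝ᵥ stiffnessMatrix p n *ᵥ v =
      (∫ x in Ioo (0 : ℝ) 1, deriv (splineOf p n u) x * deriv (splineOf p n v) x) +
      ∫ x in Ioo (0 : ℝ) 1, splineOf p n u x * splineOf p n v x := by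
  rw [stiffnessMatrix, Matrix.add_mulVec, dotProduct_add, gradMatrix_form hn, massMatrix_form hn]

theorem transpose_massMatrix (p n : ℕ) : (massMatrix p n).transpose = massMatrix p n := by
  ext i j
  simp only [massMatrix, Matrix.transpose_apply, Matrix.of_apply, mul_comm]

theorem transpose_gradMatrix (p n : ℕ) : (gradMatrix p n).transpose = gradMatrix p n := by
  ext i j
  simp only [gradMatrix, Matrix.transpose_apply, Matrix.of_apply, mul_comm]

theorem transpose_stiffnessMatrix (p n : ℕ) :
    (stiffnessMatrix p n).transpose = stiffnessMatrix p n := by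
  rw [stiffnessMatrix, Matrix.transpose_add, transpose_massMatrix, transpose_gradMatrix]

theorem posSemidef_of_form {ι : Type*} [Fintype ι] {A : Matrix ι ι ℝ} (hA : A.transpose = A)
    (h : ∀ u : ι → ℝ, 0 ≤ u ⬝ᵥ A *ᵥ u) : A.PosSemidef :=
  .of_dotProduct_mulVec_nonneg (by rwa [Matrix.IsHermitian, conjTranspose_eq_transpose_of_trivial])
    fun u => by simpa using h u

theorem posSemidef_massMatrix (hn : 0 < n) : (massMatrix p n).PosSemidef :=
  posSemidef_of_form (transpose_massMatrix p n) fun u => by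
    rw [massMatrix_form hn]
    exact integral_nonneg fun x => mul_self_nonneg _

theorem stiffnessMatrix_form_nonneg (hn : 0 < n) (u : Fin (n + p) → ℝ) :
    0 ≤ u ⬝ᵥ stiffnessMatrix p n *ᵥ u := by
  rw [stiffnessMatrix_form hn]
  exact add_nonneg (integral_nonneg fun x => mul_self_nonneg _)
    (integral_nonneg fun x => mul_self_nonneg _)

/-! ### Positivity of the inner block and of the boundary correction -/

/-- Linear independence of the inner B-splines. -/
theorem eq_zero_of_integral_sq_eq_zero (hn : 0 < n) (v : Fin (n + p) → ℝ)
    (hv : ∀ i, IsBoundary p n i → v i = 0)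
    (h : ∫ x in Ioo (0 : ℝ) 1, splineOf p n v x * splineOf p n v x = 0) : v = 0 := by
  have hpp := isPiecewisePoly_splineOf hn v
  rw [integral_eq_zero_iff_of_nonneg (fun x => mul_self_nonneg _)
    ((hpp.mul hpp).integrableOn hn)] at h
  have hmono := strictMono_uniformKnot hn
  -- Coefficients are eliminated from left to right: on the cell where the support of function i
  -- begins, later inner functions vanish and earlier coefficients are already zero.
  have key : ∀ m : ℕ, ∀ i : Fin (n + p), (i : ℕ) = m → v i = 0 := by
    intro m
    induction m using Nat.strong_induction_on with
    | _ m ih =>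
    intro i him
    by_cases hi : IsBoundary p n i
    · exact hv i hi
    have hi' := hi
    unfold IsBoundary at hi'
    have hj : (i : ℕ) - p < n := by omega
    have hlt := hmono (Nat.lt_succ_self ((i : ℕ) - p))
    -- The spline vanishes almost everywhere, and the cell has positive measure.
    obtain ⟨x, hx, hx0⟩ : ∃ x ∈ cell n (i - p), splineOf p n v x = 0 := by
      by_contra hcon
      push Not at hcon
      have h0 : ∀ᵐ x ∂(volume : Measure ℝ), x ∉ cell n (i - p) := by
        have h1 := (ae_restrict_iff' measurableSet_Ioo).1 h
        filter_upwards [h1] with x hx hxc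
        exact hcon x hxc (mul_self_eq_zero.1 (hx (cell_subset_Ioo hj hxc)))
      have h2 : volume (cell n (i - p)) = 0 := by simpa [ae_iff] using h0
      rw [cell, Real.volume_Ioo, ENNReal.ofReal_eq_zero] at h2
      unfold uniformKnot at hlt
      linarith
    have hsum : splineOf p n v x = v i * basisFun p n i x := by
      refine Finset.sum_eq_single i (fun l _ hl => ?_) (by simp)
      by_cases hlb : IsBoundary p n l
      · rw [hv l hlb, zero_mul]
      rcases lt_or_gt_of_ne (fun h => hl (Fin.ext h) : (l : ℕ) ≠ i) with h | h
      · rw [ih l (by omega) l rfl, zero_mul]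
      · rw [basisFun_eq_uniform l hlb, bspline_eq_zero_of_lt hmono.monotone, mul_zero]
        exact hx.2.trans_le (hmono.monotone (by unfold IsBoundary at hlb; omega))
    have hpos : 0 < basisFun p n i x := by
      rw [basisFun_eq_uniform i hi]
      exact bspline_pos hmono _ _ hx
    rw [hsum] at hx0
    exact (mul_eq_zero.1 hx0).resolve_right hpos.ne'
  exact funext fun i => key i i rfl

/-- After extension by zero the mass term alone is definite, by linear independence. This makes the
inverse in the Schur complement a true inverse. -/
theorem posDef_innerBlock (hn : 0 < n) :
    ((stiffnessMatrix p n).toBlock (fun i => ¬ IsBoundary p n i)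
      (fun i => ¬ IsBoundary p n i)).PosDef := by
  refine .of_dotProduct_mulVec_pos ?_ fun y hy => ?_
  · rw [Matrix.IsHermitian, conjTranspose_eq_transpose_of_trivial]
    ext i j
    exact congrFun (congrFun (transpose_stiffnessMatrix p n) i.1) j.1
  let v : Fin (n + p) → ℝ := fun i => if h : IsBoundary p n i then 0 else y ⟨i, h⟩
  have hvb : ∀ i, IsBoundary p n i → v i = 0 := fun i hi => by simp [v, hi]
  have hvy : ∀ i : {i // ¬ IsBoundary p n i}, v i = y i := fun i => by simp [v, i.2]
  have hsum : ∀ f : Fin (n + p) → ℝ, (∀ i, IsBoundary p n i → f i = 0) →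
      ∑ i, f i = ∑ i : {i // ¬ IsBoundary p n i}, f i := fun f hf => by
    rw [← Fintype.sum_subtype_add_sum_subtype (IsBoundary p n) f,
      Finset.sum_eq_zero fun i _ => hf i.1 i.2, zero_add]
  have hform : v ⬝ᵥ stiffnessMatrix p n *ᵥ v = star y ⬝ᵥ ((stiffnessMatrix p n).toBlock
      (fun i => ¬ IsBoundary p n i) (fun i => ¬ IsBoundary p n i)) *ᵥ y := by
    simp only [dotProduct, Matrix.mulVec, Pi.star_apply, star_trivial, Matrix.toBlock_apply]
    rw [hsum _ fun i hi => by rw [hvb i hi, zero_mul]]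
    refine Finset.sum_congr rfl fun i _ => ?_
    rw [hsum _ fun j hj => by rw [hvb j hj, mul_zero], hvy]
    simp only [hvy]
  rw [← hform, stiffnessMatrix_form hn]
  refine add_pos_of_nonneg_of_pos (integral_nonneg fun x => mul_self_nonneg _) ?_
  refine lt_of_le_of_ne (integral_nonneg fun x => mul_self_nonneg _) fun h => hy ?_
  have := eq_zero_of_integral_sq_eq_zero hn v hvb h.symm
  ext i
  rw [← hvy, this]
  rfl

theorem exists_harmonic_decomposition (hn : 0 < n) (u : Fin (n + p) → ℝ) :
    ∃ v : Fin (n + p) → ℝ, (∀ i, IsBoundary p n i → v i = 0) ∧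
      v ⬝ᵥ stiffnessMatrix p n *ᵥ v = v ⬝ᵥ stiffnessMatrix p n *ᵥ u ∧
      u ⬝ᵥ stiffnessMatrix p n *ᵥ u =
        u ⬝ᵥ boundaryCorrection p n *ᵥ u + v ⬝ᵥ stiffnessMatrix p n *ᵥ v :=
  exists_schur_decomposition _ (transpose_stiffnessMatrix p n) _ (posDef_innerBlock hn) u

theorem transpose_boundaryCorrection (p n : ℕ) :
    (boundaryCorrection p n).transpose = boundaryCorrection p n := by
  have hA := transpose_stiffnessMatrix p n
  have hS : (schurMatrix p n).transpose = schurMatrix p n := by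
    have h : ∀ P Q : Fin (n + p) → Prop, ((stiffnessMatrix p n).toBlock P Q).transpose =
        (stiffnessMatrix p n).toBlock Q P := fun P Q => by
      ext i j
      exact congrFun (congrFun hA i.1) j.1
    simp only [schurMatrix, Matrix.transpose_sub, Matrix.transpose_mul,
      Matrix.transpose_nonsing_inv, h, Matrix.mul_assoc]
  rw [boundaryCorrection, Matrix.transpose_reindex, Matrix.fromBlocks_transpose, hS]
  simp

/-- By a(v,v) = a(v,u), the form of C at u equals a(u,u) - a(v,v) = a(u - v, u - v), the energy of
the discrete harmonic part. -/
theorem posSemidef_boundaryCorrection (hn : 0 < n) : (boundaryCorrection p n).PosSemidef := by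
  refine posSemidef_of_form (transpose_boundaryCorrection p n) fun u => ?_
  obtain ⟨v, -, hv, huv⟩ := exists_harmonic_decomposition hn u
  have h := stiffnessMatrix_form_nonneg hn (u - v)
  have hsym : u ⬝ᵥ stiffnessMatrix p n *ᵥ v = v ⬝ᵥ stiffnessMatrix p n *ᵥ u := by
    rw [Matrix.dotProduct_mulVec, ← Matrix.mulVec_transpose, transpose_stiffnessMatrix,
      dotProduct_comm]
  rw [Matrix.mulVec_sub, dotProduct_sub, sub_dotProduct, sub_dotProduct] at h
  linarith

/-! ### The univariate and bivariate matrix inequalities -/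

/-- The univariate estimate `A ≤ C + 13 h⁻² M`. -/
theorem stiffnessMatrix_form_le (hn : 0 < n) (hp : 1 ≤ p) (u : Fin (n + p) → ℝ) :
    u ⬝ᵥ stiffnessMatrix p n *ᵥ u ≤
      u ⬝ᵥ boundaryCorrection p n *ᵥ u + 13 * n ^ 2 * (u ⬝ᵥ massMatrix p n *ᵥ u) := by
  have hup := isPiecewisePoly_splineOf (p := p) hn u
  -- Degree one is separate because v' would be piecewise constant and not admissible in the
  -- integration by parts. There u itself is piecewise affine, so the cellwise inequality bounds its
  -- whole energy, and C ≥ 0 suffices.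
  rcases eq_or_lt_of_le hp with rfl | hp2
  · have hC : 0 ≤ u ⬝ᵥ boundaryCorrection 1 n *ᵥ u := by
      simpa using (posSemidef_boundaryCorrection (p := 1) hn).dotProduct_mulVec_nonneg u
    have haff : ∀ j < n, ∃ a b : ℝ, ∀ x ∈ cell n j, splineOf 1 n u x = a + b * x := by
      intro j _
      choose a b h using fun i : Fin (n + 1) => (isGridKnots_knot 1 n).bspline_one hn i j
      refine ⟨∑ i, u i * a i, ∑ i, u i * b i, fun x hx => ?_⟩
      rw [splineOf, Finset.sum_mul, ← Finset.sum_add_distrib]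
      refine Finset.sum_congr rfl fun i _ => ?_
      rw [basisFun, h i x hx]
      ring
    have hinv := inverse_inequality_affine hn haff
    have hU : 0 ≤ ∫ x in Ioo (0 : ℝ) 1, splineOf 1 n u x ^ 2 := integral_nonneg fun x => sq_nonneg _
    have hn1 : (1 : ℝ) ≤ n ^ 2 := by exact_mod_cast Nat.one_le_pow _ _ hn
    rw [stiffnessMatrix_form hn, massMatrix_form hn]
    simp only [← sq]
    nlinarith [mul_le_mul_of_nonneg_right hn1 hU]
  · obtain ⟨k, rfl⟩ : ∃ k, p = k + 2 := ⟨p - 2, by omega⟩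
    obtain ⟨v, hvb, hv, huv⟩ := exists_harmonic_decomposition hn u
    have h := energy_le hn hup (continuousOn_splineOf hn hp u) (splineOf_mem_innerSplines v hvb)
    rw [huv, massMatrix_form hn]
    gcongr
    simp only [stiffnessMatrix_form hn, ← sq] at hv h ⊢
    refine h ?_
    rw [hv]
    simp only [mul_comm]

theorem posSemidef_univariate (hn : 0 < n) (hp : 1 ≤ p) :
    (boundaryCorrection p n + (13 * (n : ℝ) ^ 2) • massMatrix p n -
      stiffnessMatrix p n).PosSemidef := by
  refine posSemidef_of_form ?_ fun u => ?_
  · rw [Matrix.transpose_sub, Matrix.transpose_add, Matrix.transpose_smul,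
      transpose_boundaryCorrection, transpose_massMatrix, transpose_stiffnessMatrix]
  · have := stiffnessMatrix_form_le hn hp u
    rw [Matrix.sub_mulVec, Matrix.add_mulVec, Matrix.smul_mulVec, dotProduct_sub, dotProduct_add,
      dotProduct_smul, smul_eq_mul]
    linarith

open scoped Kronecker in
-- The stiffness matrix is A ⊗ M + M ⊗ A - M ⊗ M. Each direction costs 13 n² M ⊗ M, hence 26; the
-- spare M ⊗ M and the 25 surplus copies of the C terms are positive semidefinite.
theorem posSemidef_bivariate (hn : 0 < n) (hp : 1 ≤ p) :
    ((26 : ℝ) • smootherMatrix2D p n - stiffnessMatrix2D p n).PosSemidef := by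
  have hM := posSemidef_massMatrix (p := p) hn
  have hC := posSemidef_boundaryCorrection (p := p) hn
  have hX := posSemidef_univariate hn hp
  have hh : (meshSize n ^ 2)⁻¹ = (n : ℝ) ^ 2 := by
    rw [meshSize]
    simp
  have e : (26 : ℝ) • smootherMatrix2D p n - stiffnessMatrix2D p n =
      (boundaryCorrection p n + (13 * (n : ℝ) ^ 2) • massMatrix p n - stiffnessMatrix p n) ⊗ₖ
        massMatrix p n +
      massMatrix p n ⊗ₖ
        (boundaryCorrection p n + (13 * (n : ℝ) ^ 2) • massMatrix p n - stiffnessMatrix p n) +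
      massMatrix p n ⊗ₖ massMatrix p n +
      (25 : ℝ) • (boundaryCorrection p n ⊗ₖ massMatrix p n +
        massMatrix p n ⊗ₖ boundaryCorrection p n) := by
    rw [stiffnessMatrix2D_eq, smootherMatrix2D, hh, stiffnessMatrix]
    ext i j
    simp only [Matrix.add_apply, Matrix.sub_apply, Matrix.smul_apply, Matrix.kroneckerMap_apply,
      smul_eq_mul]
    ring
  rw [e]
  exact (((hX.kronecker hM).add (hM.kronecker hX)).add (hM.kronecker hM)).add
    (((hC.kronecker hM).add (hM.kronecker hC)).smul (by norm_num))

end SplineMG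

theorem lemma5p2 :
    ∃ c : ℝ, 0 < c ∧ ∀ p n₀ ℓ : ℕ, 1 ≤ p → p < n₀ →
      (c • SplineMG.smootherMatrix2D p (SplineMG.numIntervals n₀ ℓ) -
        SplineMG.stiffnessMatrix2D p (SplineMG.numIntervals n₀ ℓ)).PosSemidef := by
  refine ⟨26, by norm_num, fun p n₀ ℓ hp hpn => SplineMG.posSemidef_bivariate ?_ hp⟩
  have : 0 < n₀ := by omega
  unfold SplineMG.numIntervals
  positivity
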